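/- Let $K$ be a field and let $q,z\in K$ with $z\neq 0$ and $q^k\neq 1$ for all $k\ge 1$ (for example, $K=\mathbb{Q}(q,z)$ with $q,z$ indeterminates). Put $(a;q)_n=\prod_{k=0}^{n-1}(1-aq^k)$. For integers $A,B$ let $$\begin{bmatrix}A\\B\end{bmatrix}_q=\frac{(q;q)_A}{(q;q)_B\,(q;q)_{A-B}}\ \text{ if } 0\le B\le A,\qquad \begin{bmatrix}A\\B\end{bmatrix}_q=0\ \text{ otherwise},$$ let $\begin{bmatrix}A\\B\end{bmatrix}_q^{*}=1$ if $A=-1$ and $B=0$, and $\begin{bmatrix}A\\B\end{bmatrix}_q^{*}=\begin{bmatrix}A\\B\end{bmatrix}_q$ otherwise, and let $$T_0(L,A;q)=\sum_{r=0}^{L}(-1)^r\begin{bmatrix}L\\r\end{bmatrix}_{q^2}\begin{bmatrix}2L-2r\\L-A-r\end{bmatrix}_q$$ (an empty sum, equal to $0$, if $L<0$). For $n\ge 0$ define $$P_n=\sum_{j=0}^{n}\sum_{h=0}^{j}\sum_{i=0}^{j}\sum_{\ell=0}^{n-h-i}(-1)^{h+i+\ell}z^{h-i}q^{h^2+i^2+j^2+2\ell}\begin{bmatrix}j\\h\end{bmatrix}_{q^2}\begin{bmatrix}j\\i\end{bmatrix}_{q^2}\begin{bmatrix}j+\ell-1\\\ell\end{bmatrix}_{q^2}^{*}\begin{bmatrix}n-h-i+j-\ell\\2j\end{bmatrix}_q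 .$$ Then: (1) For every $n\ge 0$, $$P_n=\sum_{j=-\infty}^{\infty}(-1)^jz^jq^{2j^2}\bigl(T_0(n,2j;q)+T_0(n-1,2j;q)\bigr),$$ where only finitely many terms on the right-hand side are nonzero. (2) The sequence $(P_n)_{n\ge 0}$ is the unique sequence in $K$ satisfying $$P_n=(1+q-q^2+q^{2n-1})P_{n-1}+\bigl(q^3+q^2-q-(z+z^{-1})q^{2n-2}\bigr)P_{n-2}+(q^{2n-3}-q^3)P_{n-3}\qquad(n\ge 3)$$ with initial values $P_0=1$, $P_1=1+q$, $P_2=1+q+(1-z-z^{-1})q^2+q^4$. -/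

import Mathlib

noncomputable section

namespace QTrinomial

/-- The finite rising `q`-factorial `(a; q)_n = (1 - a)(1 - a q) ⋯ (1 - a q^(n-1))`. -/
def qPoch {K : Type*} [Field K] (a q : K) (n : ℕ) : K :=
  ∏ k ∈ Finset.range n, (1 - a * q ^ k)

/-- The `q`-binomial coefficient with integer entries: `(q;q)_A / ((q;q)_B (q;q)_{A-B})` if
`0 ≤ B ≤ A`, and `0` otherwise. The denominator is nonzero when no `q ^ k`, `k ≥ 1`, equals `1`. -/
def qBinom {K : Type*} [Field K] (q : K) (A B : ℤ) : K :=
  if 0 ≤ B ∧ B ≤ A then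
    qPoch q q A.toNat / (qPoch q q B.toNat * qPoch q q (A - B).toNat)
  else 0

/-- The modified `q`-binomial coefficient: it is `1` at `A = -1`, `B = 0`, and otherwise it is the
ordinary `q`-binomial coefficient. -/
def qBinomStar {K : Type*} [Field K] (q : K) (A B : ℤ) : K :=
  if A = -1 ∧ B = 0 then 1 else qBinom q A B

/-- The `q`-trinomial coefficient
`T₀(L, A; q) = ∑_{r=0}^{L} (-1)^r [L, r]_{q²} [2L - 2r, L - A - r]_q` of Andrews and Baxter;
the sum is empty when `L < 0`. -/
def T0 {K : Type*} [Field K] (L A : ℤ) (q : K) : K :=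
  ∑ r ∈ Finset.range (L + 1).toNat,
    (-1) ^ r * qBinom (q ^ 2) L r * qBinom q (2 * L - 2 * r) (L - A - r)

/-- The quadruple sum over `0 ≤ j ≤ n`, `0 ≤ h ≤ j`, `0 ≤ i ≤ j` and `0 ≤ l ≤ n - h - i`
(no values of `l` when `h + i > n`). -/
def quadSum {K : Type*} [Field K] (z q : K) (n : ℕ) : K :=
  ∑ j ∈ Finset.range (n + 1), ∑ h ∈ Finset.range (j + 1), ∑ i ∈ Finset.range (j + 1),
    ∑ l ∈ Finset.range (n + 1 - (h + i)),
      (-1) ^ (h + i + l) * z ^ ((h : ℤ) - (i : ℤ)) * q ^ (h ^ 2 + i ^ 2 + j ^ 2 + 2 * l)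
        * qBinom (q ^ 2) j h * qBinom (q ^ 2) j i
        * qBinomStar (q ^ 2) ((j : ℤ) + l - 1) l
        * qBinom q ((n : ℤ) - h - i + j - l) (2 * j)

/-- The `j`-th term `(-1)^j z^j q^(2 j²) (T₀(n, 2j; q) + T₀(n - 1, 2j; q))`, `j ∈ ℤ`. -/
def trinomialTerm {K : Type*} [Field K] (z q : K) (n : ℕ) (j : ℤ) : K :=
  (-1) ^ j * z ^ j * q ^ (2 * j ^ 2) * (T0 n (2 * j) q + T0 ((n : ℤ) - 1) (2 * j) q)

/-- The third-order recurrence together with its three initial values. -/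
def SatisfiesRecurrence {K : Type*} [Field K] (z q : K) (P : ℕ → K) : Prop :=
  P 0 = 1 ∧ P 1 = 1 + q ∧ P 2 = 1 + q + (1 - z - z⁻¹) * q ^ 2 + q ^ 4 ∧
    ∀ n : ℕ, 3 ≤ n →
      P n = (1 + q - q ^ 2 + q ^ (2 * n - 1)) * P (n - 1)
        + (q ^ 3 + q ^ 2 - q - (z + z⁻¹) * q ^ (2 * n - 2)) * P (n - 2)
        + (q ^ (2 * n - 3) - q ^ 3) * P (n - 3)

end QTrinomial

end

/-! Both sides of (1) have generating functions $F(X)$ in $n$ solving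
$$(1-X)(1-qX)(1+q^2X)F(X)=(1-qX)(1+q^2X)+qX(1-zqX)(1-z^{-1}qX)F(q^2X).$$ Comparing coefficients
gives the recurrence and its initial values, which determine the sequence; this yields (1) and (2)
together. The quadruple sum has $F=\sum_j
q^{j^2}X^j\frac{(zqX;q^2)_j(z^{-1}qX;q^2)_j}{(-q^2X;q^2)_j(X;q)_{2j+1}}$, and the equation
telescopes because $X\mapsto q^2X$ carries term $j$ to term $j+1$ up to the factors shown
(`quadTerm_succ`). The trinomial side has $F=\sum_M\theta_M X^M/(-q^2X;q^2)_M$ with $\theta_M$ =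
`evenTheta`; the three-term recurrence `evenTheta_add_two` makes its partial sums telescope too
(`defect_sum_baseSeries`). -/

noncomputable section

namespace QTrinomial

open PowerSeries

section

variable {K : Type*} [Field K]

/-! ### `q`-Pascal rules and the series of `(aX; q)_N` and its inverse -/

/-- The generating function `∑ aˡ [N + l - 1, l]* Xˡ`, which equals `1 / (aX; q)_N`. -/
def invPoch (q a : K) (N : ℕ) : K⟦X⟧ :=
  PowerSeries.mk fun l => a ^ l * qBinomStar q ((N : ℤ) + l - 1) l

/-- The generating function `∑ (-z)ʰ q^(h²) [j, h]_{q²} Xʰ`, which equals `(zqX; q²)_j`. -/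
def pochSeries (q z : K) (j : ℕ) : K⟦X⟧ :=
  PowerSeries.mk fun h => (-1) ^ h * z ^ h * q ^ (h ^ 2) * qBinom (q ^ 2) j h

lemma qPoch_succ (a q : K) (n : ℕ) : qPoch a q (n + 1) = qPoch a q n * (1 - a * q ^ n) :=
  Finset.prod_range_succ _ _

lemma one_sub_pow_ne_zero {q : K} (hq : ∀ k : ℕ, 1 ≤ k → q ^ k ≠ 1) (n : ℕ) :
    1 - q * q ^ n ≠ 0 := by
  rw [← pow_succ']
  exact sub_ne_zero.2 (hq (n + 1) (by omega)).symm

lemma qPoch_ne_zero {q : K} (hq : ∀ k : ℕ, 1 ≤ k → q ^ k ≠ 1) (n : ℕ) : qPoch q q n ≠ 0 :=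
  Finset.prod_ne_zero_iff.2 fun k _ => one_sub_pow_ne_zero hq k

lemma sq_pow_ne_one {q : K} (hq : ∀ k : ℕ, 1 ≤ k → q ^ k ≠ 1) :
    ∀ k : ℕ, 1 ≤ k → (q ^ 2) ^ k ≠ 1 := fun k hk => by
  rw [← pow_mul]; exact hq _ (by omega)

lemma qBinom_eq_zero_of_neg (q : K) {A B : ℤ} (h : B < 0) : qBinom q A B = 0 :=
  if_neg (by omega)

lemma qBinom_eq_zero_of_lt (q : K) {A B : ℤ} (h : A < B) : qBinom q A B = 0 :=
  if_neg (by omega)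

lemma qBinom_natCast_add (q : K) (a b : ℕ) :
    qBinom q ((a : ℤ) + b) a = qPoch q q (a + b) / (qPoch q q a * qPoch q q b) := by
  rw [qBinom, if_pos (by omega)]
  congr 3
  omega

lemma qBinom_zero_right {q : K} (hq : ∀ k : ℕ, 1 ≤ k → q ^ k ≠ 1) (A : ℕ) :
    qBinom q A 0 = 1 := by
  have := qBinom_natCast_add q 0 A
  simp only [Nat.cast_zero, zero_add] at this
  rw [this, show qPoch q q 0 = 1 from rfl, one_mul, div_self (qPoch_ne_zero hq A)]

lemma qBinom_self {q : K} (hq : ∀ k : ℕ, 1 ≤ k → q ^ k ≠ 1) (A : ℕ) :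
    qBinom q A A = 1 := by
  have := qBinom_natCast_add q A 0
  simp only [Nat.cast_zero, add_zero] at this
  rw [this, show qPoch q q 0 = 1 from rfl, mul_one, div_self (qPoch_ne_zero hq A)]

lemma qBinom_symm (q : K) (A B : ℤ) : qBinom q A (A - B) = qBinom q A B := by
  unfold qBinom
  by_cases h : 0 ≤ B ∧ B ≤ A
  · rw [if_pos h, if_pos (by omega), sub_sub_cancel, mul_comm (qPoch q q B.toNat)]
  · rw [if_neg h, if_neg (by omega)]

/-- The first `q`-Pascal rule. -/
lemma qBinom_pascal {q : K} (hq : ∀ k : ℕ, 1 ≤ k → q ^ k ≠ 1) (A : ℕ) (B : ℤ) :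
    qBinom q ((A : ℤ) + 1) (B + 1) = qBinom q A B + q ^ (B + 1).toNat * qBinom q A (B + 1) := by
  rcases lt_trichotomy B (-1) with h | rfl | h
  · rw [qBinom_eq_zero_of_neg q (by omega), qBinom_eq_zero_of_neg q (by omega),
      qBinom_eq_zero_of_neg q (by omega)]
    simp
  · have := qBinom_zero_right hq (A + 1)
    push_cast at this
    simp [this, qBinom_zero_right hq A, qBinom_eq_zero_of_neg]
  · lift B to ℕ using (by omega)
    rcases lt_trichotomy B A with h | rfl | h
    · obtain ⟨c, rfl⟩ := Nat.exists_eq_add_of_lt h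
      have e1 := qBinom_natCast_add q (B + 1) (c + 1)
      have e2 := qBinom_natCast_add q B (c + 1)
      have e3 := qBinom_natCast_add q (B + 1) c
      rw [show ((B + c + 1 : ℕ) : ℤ) + 1 = ((B + 1 : ℕ) : ℤ) + (c + 1 : ℕ) by push_cast; ring,
        show (B : ℤ) + 1 = (B + 1 : ℕ) by push_cast; ring, e1,
        show ((B + c + 1 : ℕ) : ℤ) = (B : ℤ) + (c + 1 : ℕ) by push_cast; ring, e2,
        show (B : ℤ) + (c + 1 : ℕ) = (B + 1 : ℕ) + (c : ℤ) by push_cast; ring, e3, Int.toNat_natCast,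
        show B + 1 + (c + 1) = (B + c + 1) + 1 by ring, show B + (c + 1) = B + c + 1 by ring,
        show B + 1 + c = B + c + 1 by ring, qPoch_succ q q (B + c + 1), qPoch_succ q q B,
        qPoch_succ q q c]
      have hB := qPoch_ne_zero hq B
      have hc := qPoch_ne_zero hq c
      have hB' := one_sub_pow_ne_zero hq B
      have hc' := one_sub_pow_ne_zero hq c
      field_simp
      ring
    · have := qBinom_self hq (B + 1)
      push_cast at this
      rw [this, qBinom_self hq, qBinom_eq_zero_of_lt q (by omega)]
      simp
    · rw [qBinom_eq_zero_of_lt q (by omega), qBinom_eq_zero_of_lt q (by omega),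
        qBinom_eq_zero_of_lt q (by omega)]
      simp

/-- The second `q`-Pascal rule. -/
lemma qBinom_pascal' {q : K} (hq : ∀ k : ℕ, 1 ≤ k → q ^ k ≠ 1) (A : ℕ) (B : ℤ) :
    qBinom q ((A : ℤ) + 1) (B + 1) = q ^ (A - B).toNat * qBinom q A B + qBinom q A (B + 1) := by
  rw [← qBinom_symm q (_ + 1), ← qBinom_symm q A B, ← qBinom_symm q A (B + 1),
    show (A : ℤ) + 1 - (B + 1) = (A - B - 1) + 1 by ring, qBinom_pascal hq,
    show (A : ℤ) - (B + 1) = A - B - 1 by ring, sub_add_cancel]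
  ring

lemma qBinomStar_zero_right {q : K} (hq : ∀ k : ℕ, 1 ≤ k → q ^ k ≠ 1) (N : ℕ) :
    qBinomStar q ((N : ℤ) - 1) 0 = 1 := by
  rcases N with _ | N
  · simp [qBinomStar]
  · rw [qBinomStar, if_neg (by omega)]
    simpa using qBinom_zero_right hq N

lemma qBinomStar_eq_qBinom (q : K) (A : ℕ) (B : ℤ) : qBinomStar q A B = qBinom q A B :=
  if_neg (by omega)

lemma qBinomStar_pascal {q : K} (hq : ∀ k : ℕ, 1 ≤ k → q ^ k ≠ 1) (N l : ℕ) :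
    qBinomStar q ((N + 1 : ℕ) + (l + 1 : ℕ) - 1) (l + 1 : ℕ) =
      qBinomStar q ((N + 1 : ℕ) + (l : ℤ) - 1) l +
        q ^ (l + 1) * qBinomStar q (N + (l + 1 : ℕ) - 1) (l + 1 : ℕ) := by
  rw [show ((N + 1 : ℕ) : ℤ) + (l + 1 : ℕ) - 1 = ((N + l + 1 : ℕ) : ℤ) by push_cast; ring,
    show ((N + 1 : ℕ) : ℤ) + l - 1 = ((N + l : ℕ) : ℤ) by push_cast; ring,
    show (N : ℤ) + (l + 1 : ℕ) - 1 = ((N + l : ℕ) : ℤ) by push_cast; ring]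
  simp only [qBinomStar_eq_qBinom]
  have := qBinom_pascal hq (N + l) l
  rw [show ((l : ℤ) + 1).toNat = l + 1 by omega] at this
  push_cast at this ⊢
  exact this

lemma qBinomStar_pascal' {q : K} (hq : ∀ k : ℕ, 1 ≤ k → q ^ k ≠ 1) (N l : ℕ) :
    qBinomStar q ((N + 1 : ℕ) + (l + 1 : ℕ) - 1) (l + 1 : ℕ) =
      q ^ N * qBinomStar q ((N + 1 : ℕ) + (l : ℤ) - 1) l +
        qBinomStar q (N + (l + 1 : ℕ) - 1) (l + 1 : ℕ) := by
  rw [show ((N + 1 : ℕ) : ℤ) + (l + 1 : ℕ) - 1 = ((N + l + 1 : ℕ) : ℤ) by push_cast; ring,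
    show ((N + 1 : ℕ) : ℤ) + l - 1 = ((N + l : ℕ) : ℤ) by push_cast; ring,
    show (N : ℤ) + (l + 1 : ℕ) - 1 = ((N + l : ℕ) : ℤ) by push_cast; ring]
  simp only [qBinomStar_eq_qBinom]
  have := qBinom_pascal' hq (N + l) l
  rw [show (((N + l : ℕ) : ℤ) - l).toNat = N by omega] at this
  push_cast at this ⊢
  exact this

/-- The two Pascal rules peel off the first factor of `(aX; q)_{N+1}` here and the last one in
`one_sub_pow_mul_invPoch`. At `N = 0` the constant term relies on the starred value at `A = -1`, `B
= 0`. -/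
lemma one_sub_mul_invPoch {q : K} (hq : ∀ k : ℕ, 1 ≤ k → q ^ k ≠ 1) (a : K) (N : ℕ) :
    (1 - C a * X) * invPoch q a (N + 1) = invPoch q (a * q) N := by
  ext l
  rcases l with _ | l
  · have h1 := qBinomStar_zero_right hq (N + 1)
    have h2 := qBinomStar_zero_right hq N
    push_cast at h1
    simp [sub_mul, mul_assoc, invPoch, h2, ← h1]
  · rw [sub_mul, one_mul, map_sub, mul_assoc, coeff_C_mul, coeff_succ_X_mul]
    simp only [invPoch, coeff_mk]
    rw [qBinomStar_pascal hq]
    ring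

lemma one_sub_pow_mul_invPoch {q : K} (hq : ∀ k : ℕ, 1 ≤ k → q ^ k ≠ 1) (a : K) (N : ℕ) :
    (1 - C (a * q ^ N) * X) * invPoch q a (N + 1) = invPoch q a N := by
  ext l
  rcases l with _ | l
  · have h1 := qBinomStar_zero_right hq (N + 1)
    have h2 := qBinomStar_zero_right hq N
    push_cast at h1
    simp [sub_mul, mul_assoc, invPoch, h2, ← h1]
  · rw [sub_mul, one_mul, map_sub, mul_assoc, coeff_C_mul, coeff_succ_X_mul]
    simp only [invPoch, coeff_mk]
    rw [qBinomStar_pascal' hq]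
    ring

lemma rescale_invPoch (q a c : K) (N : ℕ) :
    rescale c (invPoch q a N) = invPoch q (a * c) N := by
  ext l
  simp only [invPoch, coeff_rescale, coeff_mk]
  ring

lemma invPoch_zero {q : K} (a : K) : invPoch q a 0 = 1 := by
  ext l
  rcases l with _ | l
  · simp [invPoch, qBinomStar]
  · simp only [invPoch, coeff_mk, coeff_one]
    rw [qBinomStar, if_neg (by omega), qBinom_eq_zero_of_lt q (by omega)]
    simp

/-- The substitution `X ↦ q²X` shifts every factor of `(zqX; q²)_j` by one place, so only the first
factor of `(zqX; q²)_{j+1}` is missing. -/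
lemma rescale_pochSeries {q : K} (hq : ∀ k : ℕ, 1 ≤ k → q ^ k ≠ 1) (z : K) (j : ℕ) :
    (1 - C (z * q) * X) * rescale (q ^ 2) (pochSeries q z j) = pochSeries q z (j + 1) := by
  have hq2 := sq_pow_ne_one hq
  ext h
  rcases h with _ | h
  · have h1 := qBinom_zero_right hq2 (j + 1)
    have h2 := qBinom_zero_right hq2 j
    push_cast at h1
    rw [sub_mul, one_mul, map_sub, mul_assoc, coeff_C_mul, coeff_zero_X_mul]
    simp [pochSeries, coeff_rescale, h1, h2, -coeff_zero_eq_constantCoeff]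
  · rw [sub_mul, one_mul, map_sub, mul_assoc, coeff_C_mul, coeff_succ_X_mul]
    simp only [pochSeries, coeff_mk, coeff_rescale]
    have := qBinom_pascal hq2 j h
    rw [show ((h : ℤ) + 1).toNat = h + 1 by omega] at this
    push_cast at this ⊢
    rw [this]
    ring

lemma pochSeries_eq_sum (q z : K) (j : ℕ) :
    pochSeries q z j = ∑ h ∈ Finset.range (j + 1),
      C ((-1) ^ h * z ^ h * q ^ (h ^ 2) * qBinom (q ^ 2) j h) * X ^ h := by
  ext n
  simp only [pochSeries, coeff_mk, map_sum, coeff_C_mul, coeff_X_pow, mul_ite, mul_one, mul_zero,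
    Finset.sum_ite_eq, Finset.mem_range]
  split_ifs with h
  · rfl
  · rw [qBinom_eq_zero_of_lt _ (by omega), mul_zero]

/-! ### The `q`-difference equation and the recurrence -/

/-- The defect of the `q`-difference equation satisfied by the generating function of `P`. -/
def defect (q z : K) (F : K⟦X⟧) : K⟦X⟧ :=
  (1 - X) * (1 - C q * X) * (1 + C (q ^ 2) * X) * F - (1 - C q * X) * (1 + C (q ^ 2) * X)
    - C q * X * (1 - C (z * q) * X) * (1 - C (z⁻¹ * q) * X) * rescale (q ^ 2) F

lemma rescale_C (c a : K) : rescale c (C a) = C a := by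
  ext n
  rw [coeff_rescale, coeff_C]
  split_ifs with h <;> simp [h]

lemma X_pow_dvd_rescale {N : ℕ} {F : K⟦X⟧} (h : X ^ N ∣ F) (c : K) : X ^ N ∣ rescale c F := by
  rw [X_pow_dvd_iff] at h ⊢
  intro m hm
  rw [coeff_rescale, h m hm, mul_zero]

/-- `defect` is affine and continuous in the `X`-adic topology, so finite truncations suffice and no
infinite sum of series is needed. -/
lemma defect_eq_zero_of_approx {q z : K} {F : K⟦X⟧} (G : ℕ → K⟦X⟧)
    (hG : ∀ N, X ^ N ∣ F - G N) (hd : ∀ N, X ^ N ∣ defect q z (G N)) : defect q z F = 0 := by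
  have key : ∀ N, X ^ N ∣ defect q z F := by
    intro N
    have h1 := hG N
    have h2 := X_pow_dvd_rescale h1 (q ^ 2)
    rw [map_sub] at h2
    have : defect q z F = defect q z (G N)
        + (1 - X) * (1 - C q * X) * (1 + C (q ^ 2) * X) * (F - G N)
        - C q * X * (1 - C (z * q) * X) * (1 - C (z⁻¹ * q) * X)
          * (rescale (q ^ 2) F - rescale (q ^ 2) (G N)) := by
      unfold defect; ring
    rw [this]
    exact dvd_sub (dvd_add (hd N) (h1.mul_left _)) (h2.mul_left _)
  ext n
  exact X_pow_dvd_iff.1 (key (n + 1)) n (by omega)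

lemma satisfiesRecurrence_of_defect_eq_zero {z q : K} (hz : z ≠ 0) {P : ℕ → K}
    (h : defect q z (PowerSeries.mk P) = 0) : SatisfiesRecurrence z q P := by
  set F := PowerSeries.mk P with hF
  set R := rescale (q ^ 2) F with hR
  have hP : ∀ n, coeff n F = P n := fun n => coeff_mk _ _
  have hRP : ∀ n, coeff n R = (q ^ 2) ^ n * P n := fun n => by rw [hR, coeff_rescale, hP]
  have hzz : z * z⁻¹ = 1 := mul_inv_cancel₀ hz
  -- The equation solved for `F`. Its inhomogeneous part has degree 2, which is why the recurrence
  -- is homogeneous exactly from `n = 3` on.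
  have e : F = C (1 + q - q ^ 2) * (X ^ 1 * F) + C (q ^ 3 + q ^ 2 - q) * (X ^ 2 * F)
      - C (q ^ 3) * (X ^ 3 * F) + C q * (X ^ 1 * R) - C ((z + z⁻¹) * q ^ 2) * (X ^ 2 * R)
      + C (q ^ 3) * (X ^ 3 * R) + (X ^ 0 + C (q ^ 2 - q) * X ^ 1 - C (q ^ 3) * X ^ 2) := by
    have hC : C z * C z⁻¹ = (1 : K⟦X⟧) := by rw [← map_mul, hzz, map_one]
    unfold defect at h
    rw [← hR] at h
    simp only [map_add, map_sub, map_mul, map_pow, map_one] at h ⊢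
    linear_combination h + (C q) ^ 3 * X ^ 3 * R * hC
  have hc := fun n => congrArg (coeff n) e
  have hsub : ∀ n (A B : K⟦X⟧), coeff n (A - B) = coeff n A - coeff n B := fun n => map_sub _
  simp only [(coeff _).map_add, hsub, coeff_C_mul, coeff_X_pow_mul', coeff_X_pow,
    hP, hRP] at hc
  have h0 : P 0 = 1 := by simpa using hc 0
  have h1 : P 1 = 1 + q := by
    have := hc 1
    norm_num [h0] at this
    linear_combination this
  refine ⟨h0, h1, ?_, ?_⟩
  · have := hc 2
    norm_num [h0, h1] at this
    linear_combination this
  · intro n hn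
    obtain ⟨m, rfl⟩ := Nat.exists_eq_add_of_le' hn
    have := hc (m + 3)
    simp only [show 1 ≤ m + 3 by omega, show 2 ≤ m + 3 by omega, show 3 ≤ m + 3 by omega,
      show ¬m + 3 = 0 by omega, show ¬m + 3 = 1 by omega, show ¬m + 3 = 2 by omega,
      if_true, if_false] at this
    rw [show 2 * (m + 3) - 1 = 2 * m + 5 by omega, show 2 * (m + 3) - 2 = 2 * m + 4 by omega,
      show 2 * (m + 3) - 3 = 2 * m + 3 by omega, this]
    simp only [show m + 3 - 1 = m + 2 by omega, show m + 3 - 2 = m + 1 by omega,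
      show m + 3 - 3 = m by omega]
    ring

lemma SatisfiesRecurrence.unique {z q : K} {P Q : ℕ → K} (hP : SatisfiesRecurrence z q P)
    (hQ : SatisfiesRecurrence z q Q) (n : ℕ) : P n = Q n := by
  induction n using Nat.strong_induction_on with
  | _ n ih =>
    rcases Nat.lt_or_ge n 3 with h | h
    · interval_cases n
      · rw [hP.1, hQ.1]
      · rw [hP.2.1, hQ.2.1]
      · rw [hP.2.2.1, hQ.2.2.1]
    · rw [hP.2.2.2 n h, hQ.2.2.2 n h, ih _ (by omega), ih _ (by omega), ih _ (by omega)]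

/-! ### The quadruple sum -/

/-- The generating function in `n` of the part of `quadSum z q n` with given `j`. -/
def quadTerm (q z : K) (j : ℕ) : K⟦X⟧ :=
  pochSeries q z j * (pochSeries q z⁻¹ j *
    (C (q ^ (j ^ 2)) * (invPoch (q ^ 2) (-q ^ 2) j * (X ^ j * invPoch q 1 (2 * j + 1)))))

lemma coeff_X_pow_mul_invPoch (q : K) (j m : ℕ) :
    coeff m (X ^ j * invPoch q 1 (2 * j + 1)) = qBinom q ((m : ℤ) + j) (2 * j) := by
  rw [coeff_X_pow_mul']
  split_ifs with h
  · obtain ⟨c, rfl⟩ := Nat.exists_eq_add_of_le h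
    rw [Nat.add_sub_cancel_left, invPoch, coeff_mk, one_pow, one_mul,
      show ((2 * j + 1 : ℕ) : ℤ) + c - 1 = ((2 * j + c : ℕ) : ℤ) by push_cast; ring,
      qBinomStar_eq_qBinom, ← qBinom_symm]
    congr 1 <;> push_cast <;> ring
  · rw [qBinom_eq_zero_of_lt _ (by omega)]

lemma coeff_invPoch_mul (q : K) (j m : ℕ) :
    coeff m (invPoch (q ^ 2) (-q ^ 2) j * (X ^ j * invPoch q 1 (2 * j + 1))) =
      ∑ l ∈ Finset.range (m + 1), (-1) ^ l * q ^ (2 * l) *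
        qBinomStar (q ^ 2) ((j : ℤ) + l - 1) l * qBinom q ((m : ℤ) + j - l) (2 * j) := by
  rw [coeff_mul, Finset.Nat.sum_antidiagonal_eq_sum_range_succ_mk]
  refine Finset.sum_congr rfl fun l hl => ?_
  have hl : l ≤ m := Nat.lt_succ_iff.1 (Finset.mem_range.1 hl)
  simp only [coeff_X_pow_mul_invPoch]
  rw [invPoch, coeff_mk, Nat.cast_sub hl, sub_add_eq_add_sub, neg_pow, ← pow_mul]

lemma coeff_quadTerm {z : K} (hz : z ≠ 0) (q : K) (n j : ℕ) :
    coeff n (quadTerm q z j) =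
      ∑ h ∈ Finset.range (j + 1), ∑ i ∈ Finset.range (j + 1),
        ∑ l ∈ Finset.range (n + 1 - (h + i)),
          (-1) ^ (h + i + l) * z ^ ((h : ℤ) - (i : ℤ)) * q ^ (h ^ 2 + i ^ 2 + j ^ 2 + 2 * l)
            * qBinom (q ^ 2) j h * qBinom (q ^ 2) j i
            * qBinomStar (q ^ 2) ((j : ℤ) + l - 1) l
            * qBinom q ((n : ℤ) - h - i + j - l) (2 * j) := by
  rw [quadTerm, pochSeries_eq_sum, pochSeries_eq_sum, Finset.sum_mul, map_sum]
  refine Finset.sum_congr rfl fun h _ => ?_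
  rw [Finset.sum_mul, Finset.mul_sum, map_sum]
  refine Finset.sum_congr rfl fun i _ => ?_
  generalize hB : invPoch (q ^ 2) (-q ^ 2) j * (X ^ j * invPoch q 1 (2 * j + 1)) = B
  rw [show ∀ a b c : K, C a * X ^ h * (C b * X ^ i * (C c * B)) = C (a * b * c) * (X ^ (h + i) * B)
    from fun a b c => by simp only [map_mul]; ring, coeff_C_mul, coeff_X_pow_mul']
  split_ifs with hhi
  · rw [← hB, coeff_invPoch_mul, Finset.mul_sum, show n - (h + i) + 1 = n + 1 - (h + i) by omega]
    refine Finset.sum_congr rfl fun l _ => ?_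
    rw [zpow_sub₀ hz, zpow_natCast, zpow_natCast, Nat.cast_sub hhi]
    push_cast
    rw [show (n : ℤ) - (h + i) + j - l = n - h - i + j - l by ring, inv_pow, div_eq_mul_inv]
    ring
  -- For `h + i > n` truncated subtraction empties the range, matching the vanishing coefficient of
  -- `X ^ (h + i) * B`.
  · rw [show n + 1 - (h + i) = 0 by omega, Finset.range_zero, Finset.sum_empty, mul_zero]

lemma X_pow_dvd_quadTerm (q z : K) (j : ℕ) : X ^ j ∣ quadTerm q z j :=
  Dvd.intro_left (pochSeries q z j * pochSeries q z⁻¹ j * C (q ^ (j ^ 2)) *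
    invPoch (q ^ 2) (-q ^ 2) j * invPoch q 1 (2 * j + 1)) (by unfold quadTerm; ring)

/-- Under `X ↦ q²X`, `(X; q)_{2j+1}` becomes `(X; q)_{2j+3}` without its first two factors and
`(-q²X; q²)_j` becomes `(-q²X; q²)_{j+1}` without its first; the power of `q` follows from `(j+1)² =
j² + 2j + 1`. -/
lemma quadTerm_succ {q : K} (hq : ∀ k : ℕ, 1 ≤ k → q ^ k ≠ 1) (z : K) (j : ℕ) :
    (1 - X) * (1 - C q * X) * (1 + C (q ^ 2) * X) * quadTerm q z (j + 1) =
      C q * X * (1 - C (z * q) * X) * (1 - C (z⁻¹ * q) * X) * rescale (q ^ 2) (quadTerm q z j) := by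
  have e1 := one_sub_mul_invPoch hq 1 (2 * j + 2)
  have e2 := one_sub_mul_invPoch hq q (2 * j + 1)
  have e3 := one_sub_mul_invPoch (sq_pow_ne_one hq) (-q ^ 2) j
  rw [map_one, one_mul, one_mul] at e1
  unfold quadTerm
  simp only [map_mul, rescale_invPoch, ← rescale_pochSeries hq, map_pow, rescale_X, rescale_C, one_mul]
  rw [show q ^ 2 = q * q by ring, ← e2, ← e1, ← show q ^ 2 = q * q by ring, ← e3]
  simp only [map_neg, map_pow]
  rw [show 2 * (j + 1) + 1 = 2 * j + 2 + 1 by ring]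
  ring

lemma defect_sum_quadTerm {q : K} (hq : ∀ k : ℕ, 1 ≤ k → q ^ k ≠ 1) (z : K) (N : ℕ) :
    defect q z (∑ j ∈ Finset.range (N + 1), quadTerm q z j) =
      -((1 - X) * (1 - C q * X) * (1 + C (q ^ 2) * X) * quadTerm q z (N + 1)) := by
  induction N with
  | zero =>
    -- The term `j = 0` is `1 / (1 - X)`, which accounts for the inhomogeneous part.
    have e : (1 - X) * quadTerm q z 0 = 1 := by
      have e1 := one_sub_mul_invPoch hq 1 0
      rw [map_one, one_mul, invPoch_zero] at e1
      simp [quadTerm, pochSeries_eq_sum, invPoch_zero, qBinom, qPoch, e1]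
    rw [zero_add, Finset.sum_range_one, quadTerm_succ hq, defect]
    linear_combination (1 - C q * X) * (1 + C (q ^ 2) * X) * e
  | succ N ih =>
    rw [Finset.sum_range_succ]
    rw [quadTerm_succ hq z (N + 1)]
    unfold defect at ih ⊢
    rw [map_add]
    linear_combination ih

lemma defect_quadSum {z q : K} (hz : z ≠ 0) (hq : ∀ k : ℕ, 1 ≤ k → q ^ k ≠ 1) :
    defect q z (PowerSeries.mk (quadSum z q)) = 0 := by
  refine defect_eq_zero_of_approx (fun N => ∑ j ∈ Finset.range (N + 1), quadTerm q z j) ?_ ?_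
  · intro N
    rw [X_pow_dvd_iff]
    intro m hm
    rw [map_sub, coeff_mk, map_sum, sub_eq_zero,
      ← Finset.sum_subset (Finset.range_subset_range.2 (show m + 1 ≤ N + 1 by omega))]
    · simp only [coeff_quadTerm hz]
      rfl
    · intro j _ hj
      exact X_pow_dvd_iff.1 (X_pow_dvd_quadTerm q z j) m
        (by rw [Finset.mem_range] at hj; omega)
  · intro N
    simp only [defect_sum_quadTerm hq]
    exact (((pow_dvd_pow X (Nat.le_succ N)).trans (X_pow_dvd_quadTerm q z (N + 1))).mul_left _).neg_right

/-! ### Finite theta sums and their three-term recurrence -/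

lemma qBinom_add_two {q : K} (hq : ∀ k : ℕ, 1 ≤ k → q ^ k ≠ 1) (N : ℕ) (B : ℤ) :
    qBinom q ((N : ℤ) + 2) (B + 1) = (1 + q ^ (N + 1)) * qBinom q N B
      + q ^ (B + 1).toNat * qBinom q N (B + 1) + q ^ (N - B + 1).toNat * qBinom q N (B - 1) := by
  have e1 := qBinom_pascal hq (N + 1) B
  have e2 := qBinom_pascal' hq N (B - 1)
  have e3 := qBinom_pascal' hq N B
  -- The exponents add up to `N + 1` only for `0 ≤ B ≤ N`; elsewhere `toNat` truncates, but the
  -- binomial vanishes.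
  have e4 : q ^ (B + 1).toNat * q ^ (N - B).toNat * qBinom q N B = q ^ (N + 1) * qBinom q N B := by
    by_cases h : 0 ≤ B ∧ B ≤ N
    · rw [← pow_add, show (B + 1).toNat + (N - B).toNat = N + 1 by omega]
    · rw [qBinom, if_neg h, mul_zero, mul_zero]
  rw [sub_add_cancel, show (N : ℤ) - (B - 1) = N - B + 1 by ring] at e2
  push_cast at e1
  rw [show (N : ℤ) + 2 = N + 1 + 1 by ring]
  linear_combination e1 + e2 + q ^ (B + 1).toNat * e3 + e4

lemma zpow_mul_pow_eq (q : K) {a c : ℤ} {m n : ℕ} (ha : 0 ≤ a) (hc : 0 ≤ c)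
    (h : a + m = c + n) : q ^ a * q ^ m = q ^ n * q ^ c := by
  lift a to ℕ using ha
  lift c to ℕ using hc
  rw [zpow_natCast, zpow_natCast, ← pow_add, ← pow_add]
  congr 1
  omega

/-- The coefficients `q^(2j²) [2M, M - 2j]_q`. -/
def evenCoeff (q : K) (M : ℕ) (j : ℤ) : K :=
  q ^ (2 * j ^ 2) * qBinom q (2 * M) (M - 2 * j)

/-- The coefficients `q^(2j² + 2j + 1) [2M, M - 2j - 1]_q`. -/
def oddCoeff (q : K) (M : ℕ) (j : ℤ) : K :=
  q ^ (2 * j ^ 2 + 2 * j + 1) * qBinom q (2 * M) (M - 2 * j - 1)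

/-- The exponent identity is needed only on the support of the binomial. Nonnegative `a` and `c`
keep `q = 0` admissible. -/
lemma zpow_mul_pow_mul_qBinom (q : K) {a c B e : ℤ} {n : ℕ} (A B' : ℤ) (ha : 0 ≤ a) (hc : 0 ≤ c)
    (hB : B = B') (he : 0 ≤ B → B ≤ A → 0 ≤ e ∧ a + e = c + n) :
    q ^ a * (q ^ e.toNat * qBinom q A B) = q ^ n * (q ^ c * qBinom q A B') := by
  subst hB
  by_cases h : 0 ≤ B ∧ B ≤ A
  · obtain ⟨h1, h2⟩ := he h.1 h.2
    rw [← mul_assoc, ← mul_assoc, zpow_mul_pow_eq q ha hc (by omega : a + e.toNat = c + n)]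
  · rw [qBinom, if_neg h]
    simp

/-- The quadratic exponents absorb the `j`-dependent powers of `q` from the Pascal rule, leaving `q
^ M`, so that summation over `j` gives a closed recursion. -/
lemma evenCoeff_succ {q : K} (hq : ∀ k : ℕ, 1 ≤ k → q ^ k ≠ 1) (M : ℕ) (j : ℤ) :
    evenCoeff q (M + 1) j = (1 + q ^ (2 * M + 1)) * evenCoeff q M j
      + q ^ M * oddCoeff q M j + q ^ M * oddCoeff q M (j - 1) := by
  have e := qBinom_add_two hq (2 * M) (M - 2 * j)
  unfold evenCoeff oddCoeff
  have h1 : 0 ≤ 2 * j ^ 2 := by positivity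
  have h2 : 0 ≤ 2 * j ^ 2 + 2 * j + 1 := by nlinarith [sq_nonneg (j + 1)]
  have h3 : 0 ≤ 2 * (j - 1) ^ 2 + 2 * (j - 1) + 1 := by nlinarith [sq_nonneg (j - 1)]
  push_cast at e ⊢
  rw [show 2 * ((M : ℤ) + 1) = 2 * M + 2 by ring, show (M : ℤ) + 1 - 2 * j = M - 2 * j + 1 by ring,
    e, mul_add, mul_add]
  rw [zpow_mul_pow_mul_qBinom q (2 * M) (M - 2 * (j - 1) - 1) h1 h3 (by ring) (n := M),
    zpow_mul_pow_mul_qBinom q (2 * M) (M - 2 * j - 1) h1 h2 (by ring) (n := M)]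
  · ring
  · intro _ _
    exact ⟨by omega, by ring⟩
  · intro _ _
    exact ⟨by omega, by ring⟩

lemma oddCoeff_succ {q : K} (hq : ∀ k : ℕ, 1 ≤ k → q ^ k ≠ 1) (M : ℕ) (j : ℤ) :
    oddCoeff q (M + 1) j = (1 + q ^ (2 * M + 1)) * oddCoeff q M j
      + q ^ (M + 1) * evenCoeff q M j + q ^ (M + 1) * evenCoeff q M (j + 1) := by
  have e := qBinom_add_two hq (2 * M) (M - 2 * j - 1)
  unfold evenCoeff oddCoeff
  have h1 : 0 ≤ 2 * j ^ 2 := by positivity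
  have h2 : 0 ≤ 2 * j ^ 2 + 2 * j + 1 := by nlinarith [sq_nonneg (j + 1)]
  have h3 : 0 ≤ 2 * (j + 1) ^ 2 := by positivity
  push_cast at e ⊢
  rw [show 2 * ((M : ℤ) + 1) = 2 * M + 2 by ring,
    show (M : ℤ) + 1 - 2 * j - 1 = M - 2 * j - 1 + 1 by ring, e, mul_add, mul_add]
  rw [zpow_mul_pow_mul_qBinom q (2 * M) (M - 2 * j) h2 h1 (by ring) (n := M + 1),
    zpow_mul_pow_mul_qBinom q (2 * M) (M - 2 * (j + 1)) h2 h3 (by ring) (n := M + 1)]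
  · ring
  · intro _ _
    exact ⟨by omega, by push_cast; ring⟩
  · intro _ _
    exact ⟨by omega, by push_cast; ring⟩

lemma finite_support_of_forall_notMem {f : ℤ → K} (N : ℤ) (h : ∀ j, j ∉ Set.Icc (-N) N → f j = 0) :
    (Function.support f).Finite :=
  (Set.finite_Icc (-N) N).subset fun j hj => by_contra fun hn => hj (h j hn)

lemma evenCoeff_eq_zero (q : K) {M : ℕ} {j : ℤ} (h : j ∉ Set.Icc (-(M : ℤ)) M) :
    evenCoeff q M j = 0 := by
  rw [Set.mem_Icc] at h
  rw [evenCoeff, qBinom, if_neg (by omega), mul_zero]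

lemma oddCoeff_eq_zero (q : K) {M : ℕ} {j : ℤ} (h : j ∉ Set.Icc (-(M : ℤ)) M) :
    oddCoeff q M j = 0 := by
  rw [Set.mem_Icc] at h
  rw [oddCoeff, qBinom, if_neg (by omega), mul_zero]

lemma finite_support_evenCoeff (q z : K) (M : ℕ) :
    (Function.support fun j : ℤ => (-1) ^ j * z ^ j * evenCoeff q M j).Finite :=
  finite_support_of_forall_notMem M fun j hj => by rw [evenCoeff_eq_zero q hj, mul_zero]

lemma finite_support_oddCoeff (q z : K) (M : ℕ) :
    (Function.support fun j : ℤ => (-1) ^ j * z ^ j * oddCoeff q M j).Finite :=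
  finite_support_of_forall_notMem M fun j hj => by rw [oddCoeff_eq_zero q hj, mul_zero]

/-- The finite theta sum `∑_j (-z)^j q^(2j²) [2M, M - 2j]_q`. -/
def evenTheta (q z : K) (M : ℕ) : K := ∑ᶠ j : ℤ, (-1) ^ j * z ^ j * evenCoeff q M j

/-- The finite theta sum `∑_j (-z)^j q^(2j² + 2j + 1) [2M, M - 2j - 1]_q`. -/
def oddTheta (q z : K) (M : ℕ) : K := ∑ᶠ j : ℤ, (-1) ^ j * z ^ j * oddCoeff q M j

lemma finite_support_const_mul {f : ℤ → K} (h : (Function.support f).Finite) (a : K) :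
    (Function.support fun j => a * f j).Finite :=
  h.subset (Function.support_mul_subset_right (fun _ => a) f)

lemma finsum_three {f g h : ℤ → K} (hf : (Function.support f).Finite)
    (hg : (Function.support g).Finite) (hh : (Function.support h).Finite) (a b c : K) :
    ∑ᶠ j, (a * f j + b * g j + c * h j) = a * ∑ᶠ j, f j + b * ∑ᶠ j, g j + c * ∑ᶠ j, h j := by
  have hf' := finite_support_const_mul hf a
  have hg' := finite_support_const_mul hg b
  have hh' := finite_support_const_mul hh c
  rw [finsum_add_distrib ((hf'.union hg').subset (Function.support_add _ _)) hh',
    finsum_add_distrib hf' hg', mul_finsum, mul_finsum, mul_finsum]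

lemma evenTheta_succ {z q : K} (hz : z ≠ 0) (hq : ∀ k : ℕ, 1 ≤ k → q ^ k ≠ 1) (M : ℕ) :
    evenTheta q z (M + 1) =
      (1 + q ^ (2 * M + 1)) * evenTheta q z M + q ^ M * ((1 - z) * oddTheta q z M) := by
  have hs := finite_support_oddCoeff q z M
  have hs' : (Function.support fun j : ℤ =>
      (-1) ^ (j - 1) * z ^ (j - 1) * oddCoeff q M (j - 1)).Finite :=
    hs.preimage ((Equiv.subRight (1 : ℤ)).injective.injOn)
  have e : (∑ᶠ j : ℤ, (-1) ^ (j - 1) * z ^ (j - 1) * oddCoeff q M (j - 1)) = oddTheta q z M :=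
    finsum_comp_equiv (Equiv.subRight (1 : ℤ)) (f := fun j => (-1) ^ j * z ^ j * oddCoeff q M j)
  have := finsum_three (finite_support_evenCoeff q z M) hs hs' (1 + q ^ (2 * M + 1)) (q ^ M)
    (-z * q ^ M)
  rw [e] at this
  change _ = _ * evenTheta q z M + _ * oddTheta q z M + _ at this
  rw [show ∀ x : K, (1 + q ^ (2 * M + 1)) * x + q ^ M * ((1 - z) * oddTheta q z M) =
    (1 + q ^ (2 * M + 1)) * x + q ^ M * oddTheta q z M + -z * q ^ M * oddTheta q z M
    from fun x => by ring, ← this]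
  refine finsum_congr fun j => ?_
  have h1 : (-1 : K) ^ j = (-1) ^ (j - 1) * -1 := by
    rw [← zpow_add_one₀ (by simp), sub_add_cancel]
  have h2 : z ^ j = z ^ (j - 1) * z := by rw [← zpow_add_one₀ hz, sub_add_cancel]
  rw [evenCoeff_succ hq, h1, h2]
  ring

lemma oddTheta_succ {z q : K} (hz : z ≠ 0) (hq : ∀ k : ℕ, 1 ≤ k → q ^ k ≠ 1) (M : ℕ) :
    oddTheta q z (M + 1) =
      (1 + q ^ (2 * M + 1)) * oddTheta q z M + q ^ (M + 1) * ((1 - z⁻¹) * evenTheta q z M) := by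
  have hs := finite_support_evenCoeff q z M
  have hs' : (Function.support fun j : ℤ =>
      (-1) ^ (j + 1) * z ^ (j + 1) * evenCoeff q M (j + 1)).Finite :=
    hs.preimage ((Equiv.addRight (1 : ℤ)).injective.injOn)
  have e : (∑ᶠ j : ℤ, (-1) ^ (j + 1) * z ^ (j + 1) * evenCoeff q M (j + 1)) = evenTheta q z M :=
    finsum_comp_equiv (Equiv.addRight (1 : ℤ)) (f := fun j => (-1) ^ j * z ^ j * evenCoeff q M j)
  have := finsum_three (finite_support_oddCoeff q z M) hs hs' (1 + q ^ (2 * M + 1)) (q ^ (M + 1))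
    (-z⁻¹ * q ^ (M + 1))
  rw [e] at this
  change _ = _ * oddTheta q z M + _ * evenTheta q z M + _ at this
  rw [show ∀ x : K, (1 + q ^ (2 * M + 1)) * x + q ^ (M + 1) * ((1 - z⁻¹) * evenTheta q z M) =
    (1 + q ^ (2 * M + 1)) * x + q ^ (M + 1) * evenTheta q z M
      + -z⁻¹ * q ^ (M + 1) * evenTheta q z M
    from fun x => by ring, ← this]
  refine finsum_congr fun j => ?_
  rw [oddCoeff_succ hq, zpow_add_one₀ (show (-1 : K) ≠ 0 by simp), zpow_add_one₀ hz]
  field_simp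

/-- Eliminating `oddTheta` from the coupled first-order system produces `(1 - z)(1 - z⁻¹)`, the
source of `z + z⁻¹`. -/
lemma evenTheta_add_two {z q : K} (hz : z ≠ 0) (hq : ∀ k : ℕ, 1 ≤ k → q ^ k ≠ 1) (M : ℕ) :
    evenTheta q z (M + 2) =
      (1 + q + q ^ (2 * M + 2) + q ^ (2 * M + 3)) * evenTheta q z (M + 1)
        - q * (1 + (z + z⁻¹) * q ^ (2 * M + 1) + q ^ (4 * M + 2)) * evenTheta q z M := by
  have e1 := evenTheta_succ hz hq (M + 1)
  have e2 := evenTheta_succ hz hq M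
  have e3 := oddTheta_succ hz hq M
  have hzz : z * z⁻¹ = 1 := mul_inv_cancel₀ hz
  rw [e1]
  linear_combination q ^ (M + 1) * (1 - z) * e3 - q * (1 + q ^ (2 * M + 1)) * e2
    + q ^ (2 * M + 2) * evenTheta q z M * hzz

lemma evenTheta_zero {q : K} (z : K) : evenTheta q z 0 = 1 := by
  rw [evenTheta, finsum_eq_single _ 0]
  · simp [evenCoeff, qBinom, qPoch]
  · intro j hj
    rw [evenCoeff, qBinom, if_neg (by push_cast; omega), mul_zero, mul_zero]

lemma evenTheta_one {z q : K} (hz : z ≠ 0) (hq : ∀ k : ℕ, 1 ≤ k → q ^ k ≠ 1) :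
    evenTheta q z 1 = 1 + q := by
  have h : oddTheta q z 0 = 0 := by
    refine finsum_eq_zero_of_forall_eq_zero fun j => ?_
    rw [oddCoeff, qBinom, if_neg (by push_cast; omega), mul_zero, mul_zero]
  have := evenTheta_succ hz hq 0
  rw [h, evenTheta_zero] at this
  simpa using this

/-! ### The trinomial side -/

/-- With `r = n - M`, the factor `(-1)^r [n, r]_{q²}` is the coefficient of `X^r` in `1 / (-X;
q²)_{M+1}`. The bound `N` is free, so one truncation serves all `n < N`. -/
lemma T0_eq_sum (q : K) (A : ℤ) {n N : ℕ} (hn : n < N) :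
    T0 n A q = ∑ M ∈ Finset.range N,
      qBinom q (2 * M) (M - A) * coeff n (X ^ M * invPoch (q ^ 2) (-1) (M + 1)) := by
  rw [← Finset.sum_subset (Finset.range_subset_range.2 (Nat.succ_le_of_lt hn)), T0,
    show ((n : ℤ) + 1).toNat = n + 1 by omega, ← Finset.sum_range_reflect]
  · refine Finset.sum_congr rfl fun M hM => ?_
    obtain ⟨c, rfl⟩ := Nat.exists_eq_add_of_le (Nat.lt_succ_iff.1 (Finset.mem_range.1 hM))
    rw [coeff_X_pow_mul', if_pos (by omega), Nat.add_sub_cancel_left, invPoch, coeff_mk,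
      show M + c + 1 - 1 - M = c by omega,
      show ((M + 1 : ℕ) : ℤ) + c - 1 = ((M + c : ℕ) : ℤ) by push_cast; ring, qBinomStar_eq_qBinom]
    push_cast
    rw [show 2 * ((M : ℤ) + c) - 2 * c = 2 * M by ring, show (M : ℤ) + c - A - c = M - A by ring]
    ring
  · intro M _ hM
    rw [coeff_X_pow_mul', if_neg (by simpa using hM), mul_zero]

/-- Adding the shifted term multiplies the generating function by `1 + X`, which cancels the first
factor of `(-X; q²)_{M+1}`. -/
lemma T0_add_T0_eq_sum {q : K} (hq : ∀ k : ℕ, 1 ≤ k → q ^ k ≠ 1) (A : ℤ) {n N : ℕ} (hn : n < N) :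
    T0 n A q + T0 ((n : ℤ) - 1) A q = ∑ M ∈ Finset.range N,
      qBinom q (2 * M) (M - A) * coeff n (X ^ M * invPoch (q ^ 2) (-q ^ 2) M) := by
  have e : ∀ M, X ^ M * invPoch (q ^ 2) (-q ^ 2) M = X ^ M * invPoch (q ^ 2) (-1) (M + 1)
      + X * (X ^ M * invPoch (q ^ 2) (-1) (M + 1)) := fun M => by
    have := one_sub_mul_invPoch (sq_pow_ne_one hq) (-1) M
    rw [neg_one_mul, map_neg, map_one] at this
    rw [← this]
    ring
  simp only [e, map_add, mul_add, Finset.sum_add_distrib, ← T0_eq_sum q A hn]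
  congr 1
  rcases n with _ | n
  · simp [T0]
  · simp only [coeff_succ_X_mul]
    rw [← T0_eq_sum q A (by omega)]
    push_cast
    rw [add_sub_cancel_right]

lemma trinomialTerm_eq_sum {q : K} (hq : ∀ k : ℕ, 1 ≤ k → q ^ k ≠ 1) (z : K) {n N : ℕ}
    (hn : n < N) (j : ℤ) :
    trinomialTerm z q n j = ∑ M ∈ Finset.range N,
      (-1) ^ j * z ^ j * evenCoeff q M j * coeff n (X ^ M * invPoch (q ^ 2) (-q ^ 2) M) := by
  rw [trinomialTerm, T0_add_T0_eq_sum hq _ hn, Finset.mul_sum]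
  refine Finset.sum_congr rfl fun M _ => ?_
  rw [evenCoeff]
  ring

lemma finite_support_trinomialTerm {q : K} (hq : ∀ k : ℕ, 1 ≤ k → q ^ k ≠ 1) (z : K) (n : ℕ) :
    (Function.support (trinomialTerm z q n)).Finite := by
  refine finite_support_of_forall_notMem n fun j hj => ?_
  rw [trinomialTerm_eq_sum hq z (Nat.lt_succ_self n)]
  refine Finset.sum_eq_zero fun M hM => ?_
  have hM := Finset.mem_range.1 hM
  rw [Set.mem_Icc] at hj
  rw [evenCoeff_eq_zero q (by rw [Set.mem_Icc]; omega), mul_zero, zero_mul]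

/-- The series `X^M / (-q²X; q²)_M`. -/
def baseSeries (q : K) (M : ℕ) : K⟦X⟧ := X ^ M * invPoch (q ^ 2) (-q ^ 2) M

lemma finsum_trinomialTerm {q : K} (hq : ∀ k : ℕ, 1 ≤ k → q ^ k ≠ 1) (z : K) {n N : ℕ}
    (hn : n < N) :
    ∑ᶠ j : ℤ, trinomialTerm z q n j =
      coeff n (∑ M ∈ Finset.range N, C (evenTheta q z M) * baseSeries q M) := by
  simp only [trinomialTerm_eq_sum hq z hn, map_sum, coeff_C_mul]
  rw [finsum_sum_comm]
  · refine Finset.sum_congr rfl fun M _ => ?_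
    rw [evenTheta, finsum_mul, baseSeries]
  · intro M _
    exact (finite_support_evenCoeff q z M).subset (Function.support_mul_subset_left _ _)

/-- The explicit remainder makes the induction close; afterwards only its divisibility by `X ^ N`
matters. -/
lemma defect_sum_baseSeries {z q : K} (hz : z ≠ 0) (hq : ∀ k : ℕ, 1 ≤ k → q ^ k ≠ 1) (N : ℕ) :
    defect q z (∑ M ∈ Finset.range N, C (evenTheta q z M) * baseSeries q M) =
      (1 + C (q ^ 2) * X) * ((-1 + X * C (1 + q + q ^ (2 * N + 1))) * C (evenTheta q z N)
        - X * C (evenTheta q z (N + 1))) * baseSeries q N := by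
  induction N with
  | zero =>
    simp only [Finset.range_zero, Finset.sum_empty, defect, baseSeries, invPoch_zero,
      evenTheta_zero, evenTheta_one hz hq, map_add, map_zero, map_one, map_pow]
    ring
  | succ N ih =>
    have e1 := one_sub_pow_mul_invPoch (sq_pow_ne_one hq) (-q ^ 2) N
    have e2 := one_sub_mul_invPoch (sq_pow_ne_one hq) (-q ^ 2) N
    have hC : C z * C z⁻¹ = (1 : K⟦X⟧) := by rw [← map_mul, mul_inv_cancel₀ hz, map_one]
    rw [Finset.sum_range_succ]
    unfold defect at ih ⊢
    rw [map_add, map_mul (rescale (q ^ 2)), rescale_C, baseSeries, map_mul (rescale (q ^ 2)),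
      map_pow (rescale (q ^ 2)), rescale_X, rescale_invPoch, ← e2, evenTheta_add_two hz hq]
    rw [baseSeries, ← e1] at ih
    -- With `e1` and `e2` everything is over the common denominator `(-q²X; q²)_{N+1}`.
    rw [← e1]
    simp only [baseSeries, map_add, map_sub, map_mul, map_pow, map_neg, map_one, mul_pow] at ih ⊢
    linear_combination ih - C q ^ 3 * X ^ 3 * C (evenTheta q z N) * (C q ^ 2) ^ N * X ^ N *
      (1 + C q ^ 2 * X) * invPoch (q ^ 2) (-q ^ 2) (N + 1) * hC

lemma defect_finsum_trinomialTerm {z q : K} (hz : z ≠ 0) (hq : ∀ k : ℕ, 1 ≤ k → q ^ k ≠ 1) :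
    defect q z (PowerSeries.mk fun n => ∑ᶠ j : ℤ, trinomialTerm z q n j) = 0 := by
  refine defect_eq_zero_of_approx
    (fun N => ∑ M ∈ Finset.range N, C (evenTheta q z M) * baseSeries q M) ?_ ?_
  · intro N
    rw [X_pow_dvd_iff]
    intro m hm
    rw [map_sub, coeff_mk, finsum_trinomialTerm hq z hm, sub_self]
  · intro N
    simp only [defect_sum_baseSeries hz hq]
    exact (Dvd.intro _ rfl : X ^ N ∣ baseSeries q N).mul_left _

end

end QTrinomial

end

theorem mainTheorem3 {K : Type*} [Field K] (z q : K) (hz : z ≠ 0)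
    (hq : ∀ k : ℕ, 1 ≤ k → q ^ k ≠ 1) :
    (∀ n : ℕ, (Function.support (QTrinomial.trinomialTerm z q n)).Finite ∧
      QTrinomial.quadSum z q n = ∑ᶠ j : ℤ, QTrinomial.trinomialTerm z q n j) ∧
    (∀ P : ℕ → K, QTrinomial.SatisfiesRecurrence z q P ↔
      ∀ n : ℕ, P n = QTrinomial.quadSum z q n) := by
  have h1 := QTrinomial.satisfiesRecurrence_of_defect_eq_zero hz (QTrinomial.defect_quadSum hz hq)
  have h2 := QTrinomial.satisfiesRecurrence_of_defect_eq_zero hz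
    (QTrinomial.defect_finsum_trinomialTerm hz hq)
  refine ⟨fun n => ⟨QTrinomial.finite_support_trinomialTerm hq z n, h1.unique h2 n⟩, fun P => ⟨
    fun hP n => hP.unique h1 n, fun hP => ?_⟩⟩
  rwa [funext hP]
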